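/- A pizza is cut into $n\ge 1$ slices $p_0,p_1,\dots,p_{n-1}$ arranged in a circle (indices modulo $n$), with sizes $|p_i|\ge 0$ and total size $|P|=\sum_{i=0}^{n-1}|p_i|$. Alice and Bob alternately take one slice per turn until no slice is left (the Polite Pizza Protocol): Alice takes the first turn and may choose any slice; in every later turn the player on turn takes a remaining slice that is adjacent to some previously taken slice. A turn other than the first is called a \emph{shift} if the slice taken is adjacent to the slice taken by the other player in the immediately preceding turn, and a \emph{jump} otherwise. \textbf{Theorem.} For every $n\ge 1$ and every such cutting $P=p_0p_1\dots p_{n-1}$, Alice has a single strategy such that, whatever legal moves Bob makes, she makes at most two jumps during the game and the slices she takes have total size at least $\frac{4}{9}|P|$. -/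

import Mathlib

namespace Pizza

/-- Two slices of a pizza cut into `n` slices, indexed cyclically by `ZMod n`, are neighbors. -/
def IsNeighbor {n : ℕ} (i j : ZMod n) : Prop := j = i + 1 ∨ j = i - 1

instance {n : ℕ} (i j : ZMod n) : Decidable (IsNeighbor i j) :=
  inferInstanceAs (Decidable (j = i + 1 ∨ j = i - 1))

/-- A history of the game is the list of the slices taken so far, *most recent first*.
The slice `x` may be taken after history `h` if it has not been taken yet and, except in the
very first turn, has a neighbor that has already been taken (Polite Pizza Protocol). -/
def LegalMove {n : ℕ} (h : List (ZMod n)) (x : ZMod n) : Prop :=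
  x ∉ h ∧ (h = [] ∨ ∃ y ∈ h, IsNeighbor y x)

/-- The histories that can arise when both players respect the protocol. -/
inductive IsPosition {n : ℕ} : List (ZMod n) → Prop
  | nil : IsPosition []
  | cons (x : ZMod n) (h : List (ZMod n)) :
      IsPosition h → LegalMove h x → IsPosition (x :: h)

/-- Alice is on turn after history `h`: some slice is left and an even number of turns were
made (Alice makes the turns number 1, 3, 5, …). -/
def AliceOnTurn {n : ℕ} (h : List (ZMod n)) : Prop := h.length < n ∧ Even h.length

/-- Bob is on turn after history `h`. -/
def BobOnTurn {n : ℕ} (h : List (ZMod n)) : Prop := h.length < n ∧ Odd h.length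

/-- `σ` is a strategy of Alice: in every position in which she is on turn it prescribes
a legal move. (Its values on other lists play no role.) -/
def IsAliceStrategy {n : ℕ} (σ : List (ZMod n) → ZMod n) : Prop :=
  ∀ h, IsPosition h → AliceOnTurn h → LegalMove h (σ h)

/-- The histories that can arise when Alice plays according to `σ` and Bob makes arbitrary
legal moves. -/
inductive Follows {n : ℕ} (σ : List (ZMod n) → ZMod n) : List (ZMod n) → Prop
  | nil : Follows σ []
  | alice (h : List (ZMod n)) : Follows σ h → AliceOnTurn h → Follows σ (σ h :: h)
  | bob (x : ZMod n) (h : List (ZMod n)) :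
      Follows σ h → BobOnTurn h → LegalMove h x → Follows σ (x :: h)

/-- The total size of the slices taken by Alice. -/
def aliceGain {n : ℕ} (p : ZMod n → ℝ) : List (ZMod n) → ℝ
  | [] => 0
  | x :: h => aliceGain p h + if Even h.length then p x else 0

/-- The number of turns of Alice that are jumps: a turn other than the first one is a jump if
the slice taken is not a neighbor of the slice taken by the opponent in the preceding turn. -/
def aliceJumps {n : ℕ} : List (ZMod n) → ℕ
  | [] => 0
  | [_] => 0
  | x :: y :: h => aliceJumps (y :: h) +
      if Even (y :: h).length ∧ ¬ IsNeighbor y x then 1 else 0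

/-- Alice makes at most `j` jumps in every complete game in which she plays according to `σ`. -/
def IsJumpStrategy {n : ℕ} (j : ℕ) (σ : List (ZMod n) → ZMod n) : Prop :=
  ∀ h, Follows σ h → h.length = n → aliceJumps h ≤ j

/-- Playing according to `σ` guarantees Alice slices of total size at least `g`. -/
def HasGain {n : ℕ} (p : ZMod n → ℝ) (g : ℝ) (σ : List (ZMod n) → ZMod n) : Prop :=
  ∀ h, Follows σ h → h.length = n → g ≤ aliceGain p h

end Pizza

/-! For even n, shifts alone give Alice all slices of one parity, hence a half
(`exists_win_of_even`). Let n be odd. If Alice starts at x and only shifts, she ends with a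
half-circle z, z + 2, …, z + n - 1 containing x, and Bob decides which. Prefix sums `S` of step 2,
normalised by S (x + n) = S x + P/2, give it the size H z = P/2 + d z, where d z = S (z + 1) - S z.

If this fails for every x, each slice lies in a half-circle smaller than 4P/9, and three such
half-circles have cuts u < v < w pairwise an odd distance apart (`exists_cutTriple`). For a triple
of minimal total size, every half-circle Bob can force after Alice has played between u and v has
size at least min (H u) (H v) (`IsCutTriple.min_le`). Of the slices between u and v, let e be the
total of those with the parity of u and b that of the others. With one or two jumps Alice gets min
(H u) (H v) + b/2 - 3e/4, which equals P/2 - |H u - H v|/2 - e/4 (`exists_win_of_interval`). This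
cannot be below 4P/9 for all three intervals. -/

namespace Pizza

/-! ### The game on integer intervals and the phases of Alice's play -/

/-- `Win p k j u v g`: the slices taken so far are those at the integer positions `u, …, v`,
Bob is on turn, and during the next `k` rounds (a turn of Bob and a turn of Alice each) Alice can
guarantee slices of total size `g`, making at most `j` jumps. -/
def Win (p : ℤ → ℝ) : ℕ → ℕ → ℤ → ℤ → ℝ → Prop
  | 0, _, _, _, g => g ≤ 0
  | k + 1, j, u, v, g =>
    (Win p k j u (v + 2) (g - p (v + 2)) ∨
      (0 < j ∧ Win p k (j - 1) (u - 1) (v + 1) (g - p (u - 1)))) ∧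
    (Win p k j (u - 2) v (g - p (u - 2)) ∨
      (0 < j ∧ Win p k (j - 1) (u - 1) (v + 1) (g - p (v + 1))))

/-- What Alice gets by making shifts only. -/
theorem win_of_shift {p S : ℤ → ℝ} (hS : ∀ x, S (x + 2) = S x + p x) (j k : ℕ) :
    ∀ (u v : ℤ) (g : ℝ),
      (∀ i : ℕ, i ≤ k → g ≤ S (v + 2 * (k - i) + 2) - S (v + 2) + S u - S (u - 2 * i)) →
      Win p k j u v g := by
  induction k with
  | zero =>
    intro u v g h
    simpa [Win] using h 0 le_rfl
  | succ k ih =>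
    intro u v g h
    -- `i` counts Bob's turns on the left: a turn on the right keeps it, one on the left raises it
    -- by one.
    refine ⟨Or.inl (ih _ _ _ fun i hi => ?_), Or.inl (ih _ _ _ fun i hi => ?_)⟩
    · have h1 := h i (by omega)
      have h2 := hS (v + 2)
      rw [show v + 2 * (((k + 1 : ℕ) : ℤ) - i) + 2 = v + 2 + 2 * (k - i) + 2 by push_cast; ring]
        at h1
      linarith
    · have h1 := h (i + 1) (by omega)
      have h2 := hS (u - 2)
      rw [show v + 2 * (((k + 1 : ℕ) : ℤ) - ((i + 1 : ℕ) : ℤ)) + 2 = v + 2 * (k - i) + 2 by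
          push_cast; ring,
        show u - 2 * ((i + 1 : ℕ) : ℤ) = u - 2 - 2 * i by push_cast; ring] at h1
      rw [show u - 2 + 2 = u by ring] at h2
      linarith

/-- Alice makes only shifts from a position in which the slices at `x, x + 2, …, y` count as hers:
she completes them to a half-circle. -/
theorem win_outside {p S : ℤ → ℝ} (hS : ∀ x, S (x + 2) = S x + p x) {n u v : ℤ} {P K : ℝ}
    (hSn : ∀ x, S (x + n) = S x + P / 2)
    (hK : ∀ z, (z - u) % 2 = 0 → u - n < z → z < v → K ≤ P / 2 + (S (z + 1) - S z))
    (j k : ℕ) {x y : ℤ} {g : ℝ} (hx : (x - u) % 2 = 0) (huy : u ≤ y)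
    (hxv : x < v) (hk : y - x + 1 + 2 * k = n) (hg : g ≤ K - (S (y + 2) - S x)) :
    Win p k j x y g := by
  refine win_of_shift hS j k x y g fun i hi => ?_
  -- With `i` turns of Bob on the left, the counted slices grow to the half-circle of the cut `x - 2
  -- * i`.
  have h1 := hK (x - 2 * i) (by omega) (by omega) (by omega)
  have h2 := hSn (x - 2 * i + 1)
  rw [show y + 2 * ((k : ℤ) - i) + 2 = x - 2 * i + 1 + n by rw [← hk]; ring]
  linarith

/-- Alice extends her slices inside the interval `u, …, v - 1` on the positions of the parity
of `u + 1`, and jumps as soon as Bob takes an end of the interval. -/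
theorem win_inner {p S : ℤ → ℝ} (hS : ∀ x, S (x + 2) = S x + p x) {n u v : ℤ} {P K : ℝ}
    (hSn : ∀ x, S (x + n) = S x + P / 2)
    (hK : ∀ z, (z - u) % 2 = 0 → u - n < z → z < v → K ≤ P / 2 + (S (z + 1) - S z))
    (huv : (v - u) % 2 = 1) (hvn : v - u < n) (j k : ℕ) :
    ∀ (x y : ℤ) (g : ℝ), (x - u) % 2 = 1 → (y - u) % 2 = 1 → u + 1 ≤ x → x ≤ y → y ≤ v - 2 →
      y - x + 1 + 2 * k = n →
      (∀ z, (z - u) % 2 = 1 → u + 1 ≤ z → z ≤ x →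
        g ≤ K - (S (v + 1) - S v) + (S (z + 1) - S z) + S x - S (y + 2)) →
      (∀ z, (z - u) % 2 = 0 → y + 1 ≤ z → z ≤ v - 1 →
        g ≤ K - (S (u + 1) - S u) + (S (z + 1) - S z) + S x - S (y + 2)) →
      Win p k (j + 1) x y g := by
  induction k with
  -- Impossible: the interval has fewer than `n` slices, so a jump comes before the game ends.
  | zero => intro x y g hx hy h1 h2 h3 h4; omega
  | succ k ih =>
    intro x y g hx hy hux hxy hyv hk hR hL
    push_cast at hk
    constructor
    · rcases le_or_gt (y + 2) (v - 2) with h | h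
      · left
        have h2 := hS (y + 2)
        refine ih x (y + 2) _ hx (by omega) hux (by omega) h (by omega) (fun z a b c => ?_)
          (fun z a b c => ?_)
        · linarith [hR z a b c]
        · linarith [hL z a (by omega) c]
      · right
        obtain rfl : v = y + 2 := by omega
        -- The jump to `x - 1` gives both ends the parity of `u`. Of the slices `x - 1, x + 1, …, v
        -- - 1` now counted, only `x - 1` lowers the goal; the others are a loss against `K`.
        refine ⟨by omega, win_outside hS hSn hK _ k (by omega) (by omega) (by omega) (by omega) ?_⟩
        have h1 := hR x hx hux le_rfl
        have h2 := hS (x - 1)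
        rw [show x - 1 + 2 = x + 1 by ring] at h2
        rw [show y + 1 + 2 = y + 2 + 1 by ring]
        linarith
    · rcases le_or_gt (u + 1) (x - 2) with h | h
      · left
        have h2 := hS (x - 2)
        rw [show x - 2 + 2 = x by ring] at h2
        refine ih (x - 2) y _ (by omega) hy h (by omega) hyv (by omega) (fun z a b c => ?_)
          (fun z a b c => ?_)
        · linarith [hR z a b (by omega)]
        · linarith [hL z a b c]
      · right
        obtain rfl : x = u + 1 := by omega
        refine ⟨by omega, win_outside hS hSn hK _ k (by omega) (by omega) (by omega) (by omega) ?_⟩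
        have h1 := hL (y + 1) (by omega) le_rfl (by omega)
        have h2 := hS (y + 1)
        rw [show y + 1 + 1 = y + 2 by ring] at h1
        rw [show u + 1 - 1 = u by ring]
        linarith

/-- Alice extends her slices on the positions of the parity of `u` inside the interval
`l, …, r - 1`, jumps as soon as Bob takes an end of it, and continues as in `win_inner`. -/
theorem win_middle {p S : ℤ → ℝ} (hS : ∀ x, S (x + 2) = S x + p x) {n u v : ℤ} {P K G : ℝ}
    (hSn : ∀ x, S (x + n) = S x + P / 2)
    (hK : ∀ z, (z - u) % 2 = 0 → u - n < z → z < v → K ≤ P / 2 + (S (z + 1) - S z))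
    (huv : (v - u) % 2 = 1) (hvn : v - u < n) {l r s : ℤ}
    (hl : (l - u) % 2 = 1) (hr : (r - u) % 2 = 0) (hul : u + 1 ≤ l) (hrv : r ≤ v - 1)
    (hRodd : ∀ x z, (x - u) % 2 = 0 → l + 1 ≤ x → x ≤ s → (z - u) % 2 = 1 → u + 1 ≤ z → z < x →
      G ≤ K + (S (x + 1) - S x) - (S (r + 1) - S r) - (S (v + 1) - S v) + (S (z + 1) - S z))
    (hReven : ∀ x z, (x - u) % 2 = 0 → l + 1 ≤ x → x ≤ s → (z - u) % 2 = 0 → r ≤ z → z ≤ v - 1 →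
      G ≤ K + (S (x + 1) - S x) - (S (r + 1) - S r) - (S (u + 1) - S u) + (S (z + 1) - S z))
    (hLodd : ∀ y z, (y - u) % 2 = 1 → s < y → y < r → (z - u) % 2 = 1 → u + 1 ≤ z → z ≤ l →
      G ≤ K + (S (y + 1) - S y) - (S (l + 1) - S l) - (S (v + 1) - S v) + (S (z + 1) - S z))
    (hLeven : ∀ y z, (y - u) % 2 = 1 → s < y → y < r → (z - u) % 2 = 0 → y < z → z ≤ v - 1 →
      G ≤ K + (S (y + 1) - S y) - (S (l + 1) - S l) - (S (u + 1) - S u) + (S (z + 1) - S z))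
    (j k : ℕ) :
    ∀ (x y : ℤ) (g : ℝ), (x - u) % 2 = 0 → (y - u) % 2 = 0 → l + 1 ≤ x → x ≤ s → s ≤ y →
      y ≤ r - 2 → y - x + 1 + 2 * k = n → g + S (y + 2) - S x ≤ G → Win p k (j + 2) x y g := by
  induction k with
  | zero => intro x y g hx hy h1 h2 h3 h4; omega
  | succ k ih =>
    intro x y g hx hy hlx hxs hsy hyr hk hg
    push_cast at hk
    constructor
    · rcases le_or_gt (y + 2) (r - 2) with h | h
      · left
        have h2 := hS (y + 2)
        exact ih x (y + 2) _ hx (by omega) hlx hxs (by omega) h (by omega) (by linarith)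
      · right
        obtain rfl : r = y + 2 := by omega
        have h2 := hS (x - 1)
        rw [show x - 1 + 2 = x + 1 by ring] at h2
        refine ⟨by omega, win_inner hS hSn hK huv hvn j k _ _ _ (by omega) (by omega) (by omega)
          (by omega) (by omega) (by omega) (fun z a b c => ?_) (fun z a b c => ?_)⟩
        · rw [show y + 1 + 2 = y + 2 + 1 by ring]
          linarith [hRodd x z hx hlx hxs a b (by omega)]
        · rw [show y + 1 + 2 = y + 2 + 1 by ring]
          linarith [hReven x z hx hlx hxs a (by omega) c]
    · rcases le_or_gt (l + 1) (x - 2) with h | h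
      · left
        have h2 := hS (x - 2)
        rw [show x - 2 + 2 = x by ring] at h2
        exact ih (x - 2) y _ (by omega) hy h (by omega) hsy hyr (by omega) (by linarith)
      · right
        obtain rfl : x = l + 1 := by omega
        have h2 := hS (y + 1)
        refine ⟨by omega, win_inner hS hSn hK huv hvn j k _ _ _ (by omega) (by omega) (by omega)
          (by omega) (by omega) (by omega) (fun z a b c => ?_) (fun z a b c => ?_)⟩
        · have h3 := hLodd (y + 1) z (by omega) (by omega) (by omega) a b (by omega)
          rw [show y + 1 + 1 = y + 2 by ring] at h3
          rw [show l + 1 - 1 = l by ring]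
          linarith
        · have h3 := hLeven (y + 1) z (by omega) (by omega) (by omega) a (by omega) c
          rw [show y + 1 + 1 = y + 2 by ring] at h3
          rw [show l + 1 - 1 = l by ring]
          linarith

/-! ### The first slice in an interval between two cuts -/

theorem prefixSum_mono {p S : ℤ → ℝ} (hS : ∀ x, S (x + 2) = S x + p x) (hp : ∀ x, 0 ≤ p x)
    {x y : ℤ} (hxy : x ≤ y) (h : (y - x) % 2 = 0) : S x ≤ S y := by
  have key : ∀ t : ℕ, S x ≤ S (x + 2 * t) := by
    intro t
    induction t with
    | zero => simp
    | succ t ih =>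
      rw [show x + 2 * ((t + 1 : ℕ) : ℤ) = x + 2 * t + 2 by push_cast; ring, hS]
      linarith [hp (x + 2 * t)]
  have := key ((y - x) / 2).toNat
  rwa [show x + 2 * (((y - x) / 2).toNat : ℤ) = y by omega] at this

/-- Among `a, a + 2, …, b` there is a last one up to which a property of `a` persists. -/
theorem exists_last {a b : ℤ} (hab : a ≤ b) (h2 : (b - a) % 2 = 0) (Q : ℤ → Prop) (ha : Q a) :
    ∃ s, a ≤ s ∧ s ≤ b ∧ (s - a) % 2 = 0 ∧ (∀ z, a ≤ z → z ≤ s → (z - a) % 2 = 0 → Q z) ∧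
      (s = b ∨ ¬ Q (s + 2)) := by
  by_contra! hcon
  have key : ∀ t : ℕ, a + 2 * t ≤ b → ∀ z, a ≤ z → z ≤ a + 2 * t → (z - a) % 2 = 0 → Q z := by
    intro t
    induction t with
    | zero =>
      intro _ z h1 h2 _
      obtain rfl : z = a := by push_cast at h2; omega
      exact ha
    | succ t ih =>
      intro ht z h1 h3 h4
      push_cast at ht h3
      have hih := ih (by omega)
      rcases eq_or_ne z (a + 2 * t + 2) with rfl | hne
      · exact (hcon (a + 2 * t) (by omega) (by omega) (by omega) hih).2
      · exact hih z h1 (by omega) h4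
  have h := key ((b - a) / 2).toNat (by omega)
  exact (hcon b hab le_rfl h2 fun z h1 h3 h4 => h z h1 (by omega) h4).1 rfl

theorem exists_argmin (f : ℤ → ℝ) {a b : ℤ} (hab : a ≤ b) (h2 : (b - a) % 2 = 0) :
    ∃ s, a ≤ s ∧ s ≤ b ∧ (s - a) % 2 = 0 ∧
      ∀ z, a ≤ z → z ≤ b → (z - a) % 2 = 0 → f s ≤ f z := by
  obtain ⟨s, hs, hmin⟩ := Finset.exists_min_image
    ((Finset.Icc a b).filter fun z => (z - a) % 2 = 0) f ⟨b, by simp [hab]; omega⟩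
  simp only [Finset.mem_filter, Finset.mem_Icc] at hs hmin
  exact ⟨s, hs.1.1, hs.1.2, hs.2, fun z h1 h3 h4 => hmin z ⟨⟨h1, h3⟩, h4⟩⟩

/-- The gain of Alice when she starts in an interval between two cuts. -/
theorem exists_win_of_interval {p S : ℤ → ℝ} (hS : ∀ x, S (x + 2) = S x + p x)
    (hp : ∀ x, 0 ≤ p x) {m : ℕ} {u v : ℤ} {P K G : ℝ}
    (hSn : ∀ x, S (x + (2 * m + 1)) = S x + P / 2)
    (hK : ∀ z, (z - u) % 2 = 0 → u - (2 * m + 1) < z → z < v → K ≤ P / 2 + (S (z + 1) - S z))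
    (huv : (v - u) % 2 = 1) (huv' : u < v) (hvn : v - u < 2 * m + 1)
    (hbe : S (v + 1) - S u < S v - S (u + 1))
    (hG : G ≤ K + (S v - S (u + 1)) / 2 - 3 / 4 * (S (v + 1) - S u)) :
    ∃ x, Win p m 2 x x (G - p x) := by
  have hd : ∀ x, (S (x + 1) - S x) + (S (x + 2) - S (x + 1)) = p x := fun x => by
    rw [hS]; ring
  have he : S u ≤ S (v + 1) := prefixSum_mono hS hp (by omega) (by omega)
  have huv3 : u + 3 ≤ v := by
    by_contra hlt
    obtain rfl : v = u + 1 := by omega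
    linarith
  -- In the notation b, e, d: d u + d v = e - b, and `t` is chosen so that (t + d u) + (t + d v) =
  -- -e/2.
  obtain ⟨t, ht⟩ : ∃ t, t = (S v - S (u + 1)) / 2 - 3 / 4 * (S (v + 1) - S u) := ⟨_, rfl⟩
  -- One jump suffices from `s` if d z ≥ t + d v at the odd-offset cuts up to `s` and d z ≥ t + d u
  -- at the even-offset cuts after it. Taking `s` as far right as the first condition permits makes
  -- the second one weakest.
  obtain ⟨s, hs1, hs2, hs3, hsle, hsmax⟩ := exists_last (a := u + 1) (b := v - 2) (by omega)
    (by omega) (fun z => t + (S (v + 1) - S v) ≤ S (z + 1) - S z) (by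
      have h1 := hd u
      have h2 := hp u
      rw [show u + 1 + 1 = u + 2 by ring]
      linarith)
  by_cases hgood : ∀ z, (z - u) % 2 = 0 → s + 1 ≤ z → z ≤ v - 1 →
      t + (S (u + 1) - S u) ≤ S (z + 1) - S z
  · refine ⟨s, win_inner hS hSn hK huv hvn 1 m s s _ (by omega) (by omega) hs1 le_rfl hs2
      (by omega) (fun z a b c => ?_) (fun z a b c => ?_)⟩
    · have := hsle z b c (by omega)
      linarith [hS s]
    · have := hgood z a b c
      linarith [hS s]
  push Not at hgood
  obtain ⟨w, hw1, hw2, hw3, hw4⟩ := hgood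
  have hsv : s ≠ v - 2 := by
    rintro rfl
    obtain rfl : w = v - 1 := by omega
    have h1 := hd (v - 1)
    have h2 := hp (v - 1)
    rw [show v - 1 + 1 = v by ring] at h1 hw4
    rw [show v - 1 + 2 = v + 1 by ring] at h1
    linarith
  have hs5 : S (s + 2 + 1) - S (s + 2) < t + (S (v + 1) - S v) := by
    simpa using hsmax.resolve_left hsv
  -- Both conditions now fail beyond `s`. The worst cuts `r` and `l` of the two parities bound the
  -- region for the phase before the first jump.
  obtain ⟨r, hr1, hr2, hr3, hrmin⟩ := exists_argmin (fun z => S (z + 1) - S z)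
    (a := s + 1) (b := v - 1) (by omega) (by omega)
  have hr4 : S (r + 1) - S r < t + (S (u + 1) - S u) :=
    (hrmin w hw2 hw3 (by omega)).trans_lt hw4
  have hrs : r ≠ s + 1 := by
    rintro rfl
    have h1 := hd (s + 1)
    have h2 := hp (s + 1)
    rw [show s + 1 + 1 = s + 2 by ring] at h1 hr4
    rw [show s + 1 + 2 = s + 2 + 1 by ring] at h1
    linarith
  obtain ⟨l, hl1, hl2, hl3, hlmin⟩ := exists_argmin (fun z => S (z + 1) - S z)
    (a := u + 1) (b := r - 1) (by omega) (by omega)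
  have hl4 : S (l + 1) - S l < t + (S (v + 1) - S v) :=
    (hlmin (s + 2) (by omega) (by omega) (by omega)).trans_lt hs5
  have hls : s < l := by
    by_contra hcon
    have := hsle l hl1 (by omega) hl3
    linarith
  have hlr : l + 1 ≠ r := by
    -- Neighboring cuts have d l + d (l + 1) = p l ≥ 0, but the two thresholds add up to -e/2 ≤ 0.
    rintro rfl
    have h1 := hd l
    have h2 := hp l
    rw [show l + 1 + 1 = l + 2 by ring] at hr4
    linarith
  -- Alice starts at a median of the slices `l + 1, l + 3, …, r - 2`: their total is at most e, so
  -- those on either side of `k` weigh at most e/2.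
  obtain ⟨k, hk1, hk2, hk3, hkle, hkmax⟩ := exists_last (a := l + 1) (b := r - 2) (by omega)
    (by omega) (fun z => S z - S (l + 1) ≤ (S (v + 1) - S u) / 2) (by linarith)
  have hkl := hkle k hk1 le_rfl hk3
  have hkr : S r - S (k + 2) ≤ (S (v + 1) - S u) / 2 := by
    rcases hkmax with rfl | h
    · rw [show r - 2 + 2 = r by ring]; linarith
    · have h1 : S u ≤ S (l + 1) := prefixSum_mono hS hp (by omega) (by omega)
      have h2 : S r ≤ S (v + 1) := prefixSum_mono hS hp (by omega) (by omega)
      push Not at h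
      linarith
  have hx : ∀ x, (x - u) % 2 = 0 → l + 1 ≤ x → x ≤ k →
      -((S (v + 1) - S u) / 2) ≤ (S (x + 1) - S x) + (S (l + 1) - S l) := fun x h1 h2 h3 => by
    have h4 : S x ≤ S k := prefixSum_mono hS hp h3 (by omega)
    have h5 : S l ≤ S (x + 1) := prefixSum_mono hS hp (by omega) (by omega)
    linarith
  have hy : ∀ y, (y - u) % 2 = 1 → k < y → y < r →
      -((S (v + 1) - S u) / 2) ≤ (S (y + 1) - S y) + (S (r + 1) - S r) := fun y h1 h2 h3 => by
    have h4 : S (k + 2) ≤ S (y + 1) := prefixSum_mono hS hp (by omega) (by omega)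
    have h5 : S y ≤ S (r + 1) := prefixSum_mono hS hp (by omega) (by omega)
    linarith
  refine ⟨k, win_middle (G := G) (l := l) (r := r) (s := k) hS hSn hK huv hvn (by omega) (by omega)
    hl1 hr2 ?_ ?_ ?_ ?_ 0 m k k _ (by omega) (by omega) hk1 le_rfl le_rfl hk2 (by omega)
    (by linarith [hS k])⟩
  -- Minimality of `l` or `r` controls the second jump; the remaining terms give at least -e/2 - (e
  -- - b) - t = t, or the same bound with the thresholds exchanged.
  · intro x z h1 h2 h3 h4 h5 h6
    have := hx x h1 h2 h3
    have := hlmin z h5 (by omega) (by omega)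
    linarith
  · intro x z h1 h2 h3 h4 h5 h6
    have := hx x h1 h2 h3
    have := hrmin z (by omega) h6 (by omega)
    linarith
  · intro y z h1 h2 h3 h4 h5 h6
    have := hy y h1 h2 h3
    have := hlmin z h5 (by omega) (by omega)
    linarith
  · intro y z h1 h2 h3 h4 h5 h6
    have := hy y h1 h2 h3
    have := hrmin z (by omega) h6 (by omega)
    linarith

/-! ### Triples of cuts with small half-circles -/

/-- Three cuts of a pizza with `n` slices (the cut `u` lies between the slices `u - 1` and `u`) that
are pairwise an odd number of slices apart, whose half-circles all have size less than `τ`. -/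
structure IsCutTriple (H : ℤ → ℝ) (τ : ℝ) (n u v w : ℤ) : Prop where
  lt_uv : u < v
  lt_vw : v < w
  lt_wu : w < u + n
  odd_uv : (v - u) % 2 = 1
  odd_vw : (w - v) % 2 = 1
  small_u : H u < τ
  small_v : H v < τ
  small_w : H w < τ

theorem IsCutTriple.rotate {H : ℤ → ℝ} {τ : ℝ} {n u v w : ℤ} (hH : ∀ x, H (x + n) = H x)
    (hn : n % 2 = 1) (h : IsCutTriple H τ n u v w) : IsCutTriple H τ n v w (u + n) where
  lt_uv := h.lt_vw
  lt_vw := h.lt_wu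
  lt_wu := by have := h.lt_uv; omega
  odd_uv := h.odd_vw
  odd_vw := by have := h.odd_uv; have := h.odd_vw; omega
  small_u := h.small_v
  small_v := h.small_w
  small_w := by rw [hH]; exact h.small_u

/-- Translation by multiples of `n` brings every triple into a finite window without changing its
total. -/
theorem exists_minimal_cutTriple {H : ℤ → ℝ} {τ : ℝ} {n : ℤ} (hn : 0 < n)
    (hH : ∀ x, H (x + n) = H x) (hex : ∃ u v w, IsCutTriple H τ n u v w) :
    ∃ u v w, IsCutTriple H τ n u v w ∧
      ∀ u' v' w', IsCutTriple H τ n u' v' w' → H u + H v + H w ≤ H u' + H v' + H w' := by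
  classical
  have hper : ∀ x t : ℤ, H (x - n * t) = H x := fun x t => by
    have := (show Function.Periodic H n from hH).sub_zsmul_eq (x := x) t
    rwa [zsmul_eq_mul, Int.cast_id, mul_comm] at this
  have hnorm : ∀ u v w, IsCutTriple H τ n u v w → ∃ u' v' w', IsCutTriple H τ n u' v' w' ∧
      0 ≤ u' ∧ u' < n ∧ H u' + H v' + H w' = H u + H v + H w := fun u v w h => by
    have h1 := Int.emod_add_mul_ediv u n
    have h2 := Int.emod_nonneg u hn.ne'
    have h3 := Int.emod_lt_of_pos u hn
    obtain ⟨a, b, c, d, e, f, g, i⟩ := h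
    have hq : ∀ x, H (x - n * (u / n)) = H x := fun x => hper x _
    generalize n * (u / n) = q at *
    exact ⟨u - q, v - q, w - q, ⟨by omega, by omega, by omega, by omega, by omega, by rwa [hq],
      by rwa [hq], by rwa [hq]⟩, by omega, by omega, by rw [hq, hq, hq]⟩
  obtain ⟨u₀, v₀, w₀, h₀⟩ := hex
  obtain ⟨u₁, v₁, w₁, h₁, hu₁, hu₁', -⟩ := hnorm _ _ _ h₀
  obtain ⟨⟨u, v, w⟩, hmem, hmin⟩ := Finset.exists_min_image
    ((Finset.Ico 0 n ×ˢ Finset.Ico 0 (2 * n) ×ˢ Finset.Ico 0 (2 * n)).filter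
      fun t => IsCutTriple H τ n t.1 t.2.1 t.2.2)
    (fun t => H t.1 + H t.2.1 + H t.2.2)
    ⟨(u₁, v₁, w₁), by
      have := h₁.lt_uv; have := h₁.lt_vw; have := h₁.lt_wu
      simp only [Finset.mem_filter, Finset.mem_product, Finset.mem_Ico]
      exact ⟨by omega, h₁⟩⟩
  refine ⟨u, v, w, (Finset.mem_filter.1 hmem).2, fun u' v' w' h' => ?_⟩
  obtain ⟨u₂, v₂, w₂, h₂, hu₂, hu₂', heq⟩ := hnorm _ _ _ h'
  rw [← heq]
  refine hmin (u₂, v₂, w₂) ?_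
  have := h₂.lt_uv; have := h₂.lt_vw; have := h₂.lt_wu
  simp only [Finset.mem_filter, Finset.mem_product, Finset.mem_Ico]
  exact ⟨by omega, h₂⟩

/-- In a cut triple of minimal total size, every half-circle that meets the overlap of two of the
three half-circles is at least as large as one of these two. -/
theorem IsCutTriple.min_le {H : ℤ → ℝ} {τ : ℝ} {n u v w : ℤ} (hH : ∀ x, H (x + n) = H x)
    (hn : n % 2 = 1) (h : IsCutTriple H τ n u v w)
    (hmin : ∀ u' v' w', IsCutTriple H τ n u' v' w' → H u + H v + H w ≤ H u' + H v' + H w')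
    {z : ℤ} (hz : (z - u) % 2 = 0) (huz : u - n < z) (hzv : z < v) : min (H u) (H v) ≤ H z := by
  obtain ⟨a, b, c, d, e, f, g, i⟩ := h
  rcases le_or_gt τ (H z) with hτ | hτ
  · exact (min_le_left _ _).trans (f.le.trans hτ)
  -- If `z` is small it can replace `u` or, moved by `n`, replace `v`, depending on its side of the
  -- cut `w - n`, which has the other parity.
  rcases lt_or_ge (w - n) z with h1 | h1
  · have := hmin z v w ⟨hzv, b, by omega, by omega, e, hτ, g, i⟩
    exact (min_le_left _ _).trans (by linarith)
  · have := hmin u (z + n) w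
      ⟨by omega, by omega, c, by omega, by omega, f, by rwa [hH], i⟩
    rw [hH] at this
    exact (min_le_right _ _).trans (by linarith)

/-- If every slice lies in a half-circle of size less than `τ` but no two neighboring cuts have
such half-circles, then there is a cut triple. -/
theorem exists_cutTriple {H : ℤ → ℝ} {τ : ℝ} {n : ℤ} (hn : n % 2 = 1) (hn0 : 0 < n)
    (hH : ∀ x, H (x + n) = H x) (hadj : ∀ x, H x < τ → τ ≤ H (x + 1))
    (hcov : ∀ x, ∃ u, (x - u) % 2 = 0 ∧ x - n < u ∧ u ≤ x ∧ H u < τ) :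
    ∃ u v w, IsCutTriple H τ n u v w := by
  obtain ⟨u, -, -, -, hu⟩ := hcov 0
  -- `w` is the last small cut of the parity of `u` within one turn of the circle. A small
  -- half-circle through the slice `w + 1` then has its cut `v` strictly between `u` and `w`:
  -- otherwise `v + n` would contradict maximality.
  obtain ⟨w, hw, hmax⟩ := Finset.exists_max_image
    ((Finset.Ico u (u + n)).filter fun z => (z - u) % 2 = 0 ∧ H z < τ) id
    ⟨u, by simp [hn0, hu]⟩
  simp only [Finset.mem_filter, Finset.mem_Ico, id] at hw hmax
  obtain ⟨⟨hw1, hw2⟩, hw3, hw4⟩ := hw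
  have hwn : w ≠ u + n - 1 := by
    rintro rfl
    have := hadj _ hw4
    rw [show u + n - 1 + 1 = u + n by ring, hH] at this
    linarith
  obtain ⟨v, hv1, hv2, hv3, hv4⟩ := hcov (w + 1)
  have hvw : v ≠ w + 1 := by
    rintro rfl
    linarith [hadj _ hw4]
  have huv : u < v := by
    by_contra hcon
    have := hmax (v + n) ⟨⟨by omega, by omega⟩, by omega, by rwa [hH]⟩
    omega
  exact ⟨u, v, w, huv, by omega, hw2, by omega, by omega, hu, hv4, hw4⟩

/-! ### Four ninths for an odd number of slices -/

/-- On a pizza with an odd number of slices Alice can get four ninths with two jumps. -/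
theorem exists_win_of_odd {p S : ℤ → ℝ} (hS : ∀ x, S (x + 2) = S x + p x)
    (hp : ∀ x, 0 ≤ p x) {m : ℕ} {P : ℝ} (hSn : ∀ x, S (x + (2 * m + 1)) = S x + P / 2)
    (hP : 0 ≤ P) : ∃ x, Win p m 2 x x (4 * P / 9 - p x) := by
  by_contra! hno
  obtain ⟨n, hn⟩ : ∃ n : ℤ, n = 2 * m + 1 := ⟨_, rfl⟩
  obtain ⟨H, hHdef⟩ : ∃ H : ℤ → ℝ, ∀ x, H x = P / 2 + (S (x + 1) - S x) := ⟨_, fun _ => rfl⟩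
  have hSn' : ∀ x, S (x + n) = S x + P / 2 := fun x => by rw [hn, hSn]
  have hH : ∀ x, H (x + n) = H x := fun x => by
    rw [hHdef, hHdef, show x + n + 1 = x + 1 + n by ring, hSn', hSn']; ring
  have hn2 : n % 2 = 1 := by omega
  -- The half-circles of two neighboring cuts cover the pizza and share only the slice `x`.
  have hadj' : ∀ x, P ≤ H x + H (x + 1) := fun x => by
    rw [hHdef, hHdef, show x + 1 + 1 = x + 2 by ring, hS]
    linarith [hp x]
  have hcov : ∀ x, ∃ u, (x - u) % 2 = 0 ∧ x - n < u ∧ u ≤ x ∧ H u < 4 * P / 9 := by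
    intro x
    by_contra! hcon
    refine hno x (win_of_shift hS 2 m x x _ fun i hi => ?_)
    have h1 := hcon (x - 2 * i) (by omega) (by omega) (by omega)
    rw [hHdef] at h1
    have h2 := hSn (x - 2 * i + 1)
    rw [show x + 2 * ((m : ℤ) - i) + 2 = x - 2 * i + 1 + (2 * m + 1) by ring]
    linarith [hS x]
  obtain ⟨u, v, w, h, hmin⟩ := exists_minimal_cutTriple (n := n) (by omega) hH
    (exists_cutTriple hn2 (by omega) hH (fun x hx => by linarith [hadj' x]) hcov)
  have hint : ∀ u v w, IsCutTriple H (4 * P / 9) n u v w →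
      (∀ u' v' w', IsCutTriple H (4 * P / 9) n u' v' w' →
        H u + H v + H w ≤ H u' + H v' + H w') →
      min (H u) (H v) + (S v - S (u + 1)) / 2 - 3 / 4 * (S (v + 1) - S u) < 4 * P / 9 := by
    intro u v w h hmin
    by_contra! hcon
    obtain ⟨x, hx⟩ := exists_win_of_interval hS hp hSn
      (fun z h1 h2 h3 => (h.min_le hH hn2 hmin h1 (by omega) h3).trans (hHdef z).le)
      h.odd_uv h.lt_uv (by have := h.lt_vw; have := h.lt_wu; omega)
      (by linarith [h.small_u, h.small_v, hHdef u, hHdef v]) hcon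
    exact hno x hx
  have hrot := h.rotate hH hn2
  have i1 := hint u v w h hmin
  have i2 := hint v w (u + n) hrot fun u' v' w' h' => by
    rw [hH]; linarith [hmin u' v' w' h']
  have i3 := hint w (u + n) (v + n) (hrot.rotate hH hn2) fun u' v' w' h' => by
    rw [hH, hH]; linarith [hmin u' v' w' h']
  rw [show u + n + 1 = u + 1 + n by ring, hH, hSn', hSn'] at i3
  have e1 : S u ≤ S (v + 1) :=
    prefixSum_mono hS hp (by have := h.lt_uv; omega) (by have := h.odd_uv; omega)
  have e2 : S v ≤ S (w + 1) :=
    prefixSum_mono hS hp (by have := h.lt_vw; omega) (by have := h.odd_vw; omega)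
  have e3 : S w ≤ S (u + 1 + n) :=
    prefixSum_mono hS hp (by have := h.lt_wu; omega) (by have := h.odd_uv; have := h.odd_vw; omega)
  rw [hSn'] at e3
  have := h.small_u
  have := h.small_v
  have := h.small_w
  have := hHdef u
  have := hHdef v
  have := hHdef w
  -- Let α ≤ β ≤ γ be the sizes and e, e' the sums for the intervals between the cuts of α, β and of
  -- β, γ. Then e > 2P/9 - 2(β - α), e' > 2P/9 - 2(γ - β) and e + e' ≤ α + β + γ - P. With γ < 4P/9,
  -- the bound on e' gives α > β - P/9, while both together give β > α + P/9.
  rcases le_total (H u) (H v) with h1 | h1 <;> rcases le_total (H v) (H w) with h2 | h2 <;>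
    rcases le_total (H w) (H u) with h3 | h3 <;>
    simp only [min_eq_left, min_eq_right, h1, h2, h3] at i1 i2 i3 <;> linarith

/-! ### Construction of the prefix sums, and even pizzas -/

theorem exists_antidifference (q : ℤ → ℝ) : ∃ F : ℤ → ℝ, ∀ y, F (y + 1) = F y + q y := by
  refine ⟨fun y => ∑ i ∈ Finset.range y.toNat, q i -
    ∑ i ∈ Finset.range (-y).toNat, q (-(i + 1 : ℤ)), fun y => ?_⟩
  beta_reduce
  rcases le_or_gt 0 y with h | h
  · obtain ⟨k, rfl⟩ := Int.eq_ofNat_of_zero_le h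
    rw [show ((k : ℤ) + 1).toNat = k + 1 by omega, show (-((k : ℤ) + 1)).toNat = 0 by omega,
      show (k : ℤ).toNat = k by omega, show (-(k : ℤ)).toNat = 0 by omega, Finset.sum_range_succ]
    ring
  · obtain ⟨k, rfl⟩ : ∃ k : ℕ, y = -(k + 1 : ℤ) := ⟨(-y - 1).toNat, by omega⟩
    rw [show (-((k : ℤ) + 1) + 1).toNat = 0 by omega,
      show (-(-((k : ℤ) + 1) + 1)).toNat = k by omega,
      show (-((k : ℤ) + 1)).toNat = 0 by omega, show (-(-((k : ℤ) + 1))).toNat = k + 1 by omega,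
      Finset.sum_range_succ]
    ring

theorem exists_prefixSum (p : ℤ → ℝ) : ∃ S : ℤ → ℝ, ∀ x, S (x + 2) = S x + p x := by
  obtain ⟨F, hF⟩ := exists_antidifference fun y => p (2 * y)
  obtain ⟨F', hF'⟩ := exists_antidifference fun y => p (2 * y + 1)
  refine ⟨fun x => if x % 2 = 0 then F (x / 2) else F' (x / 2), fun x => ?_⟩
  simp only [Int.add_emod_right, show (x + 2) / 2 = x / 2 + 1 by omega]
  split_ifs with h
  · rw [hF, show 2 * (x / 2) = x by omega]
  · rw [hF', show 2 * (x / 2) + 1 = x by omega]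

theorem sum_eq_prefixSum {p S : ℤ → ℝ} (hS : ∀ x, S (x + 2) = S x + p x) (n : ℕ) :
    ∑ i ∈ Finset.range n, p i = S n + S (n + 1) - S 0 - S 1 := by
  induction n with
  | zero => simp
  | succ k ih =>
    rw [Finset.sum_range_succ, ih, show ((k + 1 : ℕ) : ℤ) + 1 = k + 2 by push_cast; ring, hS]
    push_cast
    ring

theorem prefixSum_add_period {p S : ℤ → ℝ} (hS : ∀ x, S (x + 2) = S x + p x) {n : ℤ}
    (hp : ∀ x, p (x + n) = p x) (x y : ℤ) (hxy : (y - x) % 2 = 0) :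
    S (x + n) - S x = S (y + n) - S y := by
  have key : ∀ (x : ℤ) (t : ℕ), S (x + 2 * t + n) - S (x + 2 * t) = S (x + n) - S x := by
    intro x t
    induction t with
    | zero => simp
    | succ t ih =>
      have h1 := hS (x + 2 * t)
      have h2 := hS (x + 2 * t + n)
      rw [hp] at h2
      rw [show x + 2 * ((t + 1 : ℕ) : ℤ) = x + 2 * t + 2 by push_cast; ring,
        show x + 2 * (t : ℤ) + 2 + n = x + 2 * t + n + 2 by ring]
      linarith
  rcases le_total x y with h | h
  · have := key x ((y - x) / 2).toNat
    rw [show x + 2 * (((y - x) / 2).toNat : ℤ) = y by omega] at this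
    exact this.symm
  · have := key y ((x - y) / 2).toNat
    rwa [show y + 2 * (((x - y) / 2).toNat : ℤ) = x by omega] at this

theorem exists_prefixSum_of_odd {p : ℤ → ℝ} {m : ℕ} (hp : ∀ x, p (x + (2 * m + 1)) = p x) :
    ∃ S : ℤ → ℝ, (∀ x, S (x + 2) = S x + p x) ∧
      ∀ x, S (x + (2 * m + 1)) = S x + (∑ i ∈ Finset.range (2 * m + 1), p i) / 2 := by
  obtain ⟨S, hS⟩ := exists_prefixSum p
  have hsum := sum_eq_prefixSum hS (2 * m + 1)
  rw [show (((2 * m + 1 : ℕ) : ℤ) + 1) = 1 + (2 * m + 1) by push_cast; ring,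
    show ((2 * m + 1 : ℕ) : ℤ) = 0 + (2 * m + 1) by push_cast; ring] at hsum
  have hper := prefixSum_add_period hS hp
  generalize (∑ i ∈ Finset.range (2 * m + 1), p i) = P at *
  -- The increments over `n` depend only on parity and add up to `P`; a constant added on the odd
  -- integers makes both equal to `P / 2`.
  refine ⟨fun x => S x + if x % 2 = 0 then 0 else
    ((S (1 + (2 * m + 1)) - S 1) - (S (0 + (2 * m + 1)) - S 0)) / 2, fun x => ?_, fun x => ?_⟩
  · simp only [Int.add_emod_right, hS]
    ring
  · beta_reduce
    rcases Int.emod_two_eq_zero_or_one x with h | h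
    · rw [if_pos h, if_neg (by omega)]
      linarith [hper 0 x (by omega)]
    · rw [if_neg (by omega : ¬ x % 2 = 0), if_pos (by omega)]
      linarith [hper 1 x (by omega)]

/-- On a pizza with an even number of slices Alice gets one half by shifts. -/
theorem exists_win_of_even {p : ℤ → ℝ} {m : ℕ} (hp : ∀ x, p (x + (2 * m + 2)) = p x) :
    ∃ x, Win p m 2 x x ((∑ i ∈ Finset.range (2 * m + 2), p i) / 2 - p x) := by
  obtain ⟨S, hS⟩ := exists_prefixSum p
  have hsum := sum_eq_prefixSum hS (2 * m + 2)
  have hper := prefixSum_add_period hS hp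
  rw [show (((2 * m + 2 : ℕ) : ℤ) + 1) = 1 + (2 * m + 2) by push_cast; ring,
    show ((2 * m + 2 : ℕ) : ℤ) = 0 + (2 * m + 2) by push_cast; ring] at hsum
  have key : ∀ x, (∑ i ∈ Finset.range (2 * m + 2), p i) / 2 ≤ S (x + (2 * m + 2)) - S x →
      Win p m 2 x x ((∑ i ∈ Finset.range (2 * m + 2), p i) / 2 - p x) := fun x hx => by
    refine win_of_shift hS 2 m x x _ fun i _ => ?_
    have h1 := hper x (x - 2 * i) (by omega)
    rw [show x + 2 * ((m : ℤ) - i) + 2 = x - 2 * i + (2 * m + 2) by ring]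
    linarith [hS x]
  rcases le_total (S (1 + (2 * m + 2)) - S 1) (S (0 + (2 * m + 2)) - S 0) with h | h
  · exact ⟨0, key 0 (by linarith)⟩
  · exact ⟨1, key 1 (by linarith)⟩

/-! ### From `Win` to strategies on `ZMod n` -/

theorem sum_zmod_eq_sum_range (n : ℕ) [NeZero n] (p : ZMod n → ℝ) :
    ∑ i, p i = ∑ i ∈ Finset.range n, p ((i : ℤ) : ZMod n) := by
  obtain ⟨k, rfl⟩ := Nat.exists_eq_succ_of_ne_zero (NeZero.ne n)
  rw [Finset.sum_range]
  refine Finset.sum_congr rfl fun i _ => ?_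
  congr 1
  have := ZMod.natCast_zmod_val (n := k + 1) i
  rw [Int.cast_natCast]
  exact this.symm

/-- A strategy must also prescribe legal moves in positions that its own play never reaches. -/
theorem exists_legalMove {n : ℕ} [NeZero n] (h : List (ZMod n)) (hn : h.length < n) :
    ∃ x, LegalMove h x := by
  by_contra! hcon
  have h0 : h ≠ [] := by
    rintro rfl
    exact hcon 0 ⟨by simp, Or.inl rfl⟩
  obtain ⟨a, ha⟩ := List.exists_mem_of_ne_nil h h0
  have hclosed : ∀ y ∈ h, y + 1 ∈ h := fun y hy => by
    by_contra hy1
    exact hcon (y + 1) ⟨hy1, Or.inr ⟨y, hy, Or.inl rfl⟩⟩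
  have hnat : ∀ t : ℕ, a + t ∈ h := fun t => by
    induction t with
    | zero => simpa using ha
    | succ t ih =>
      rw [Nat.cast_succ, ← add_assoc]
      exact hclosed _ ih
  have hall : ∀ x, x ∈ h := fun x => by
    have := hnat (x - a).val
    rwa [ZMod.natCast_zmod_val, add_sub_cancel] at this
  have hcard := Finset.card_le_card
    (show (Finset.univ : Finset (ZMod n)) ⊆ h.toFinset from fun x _ => by simp [hall x])
  rw [Finset.card_univ, ZMod.card] at hcard
  exact absurd (hcard.trans h.toFinset_card_le) (by omega)

/-- A strategy of Alice that maintains an invariant `Q` of the histories after her turns. -/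
theorem exists_strategy_of_invariant {n : ℕ} [NeZero n] (Q : List (ZMod n) → Prop)
    (h0 : ∃ x, Q [x])
    (hstep : ∀ h y, Q h → BobOnTurn h → LegalMove h y → (y :: h).length < n →
      ∃ x, LegalMove (y :: h) x ∧ Q (x :: y :: h)) :
    ∃ σ, IsAliceStrategy σ ∧ ∀ h, Follows σ h → (Odd h.length → Q h) ∧
      (Even h.length → h = [] ∨ ∃ y t, h = y :: t ∧ Q t ∧ BobOnTurn t ∧ LegalMove t y) := by
  classical
  have hσ : ∀ h : List (ZMod n), ∃ x, (h.length < n → LegalMove h x) ∧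
      ((∃ z, LegalMove h z ∧ Q (z :: h)) → Q (x :: h)) := fun h => by
    by_cases hz : ∃ z, LegalMove h z ∧ Q (z :: h)
    · obtain ⟨z, hz1, hz2⟩ := hz
      exact ⟨z, fun _ => hz1, fun _ => hz2⟩
    · by_cases hn : h.length < n
      · obtain ⟨x, hx⟩ := exists_legalMove h hn
        exact ⟨x, fun _ => hx, fun h => absurd h hz⟩
      · exact ⟨0, fun h => absurd h hn, fun h => absurd h hz⟩
  choose σ hσ1 hσ2 using hσ
  refine ⟨σ, fun h _ hA => hσ1 h hA.1, fun h hF => ?_⟩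
  induction hF with
  | nil => exact ⟨fun h => by simp at h, fun _ => Or.inl rfl⟩
  | alice h _ hA ih =>
    refine ⟨fun _ => hσ2 h ?_, fun he => ?_⟩
    · rcases ih.2 hA.2 with rfl | ⟨y, t, rfl, ht, hB, hy⟩
      · obtain ⟨x, hx⟩ := h0
        exact ⟨x, ⟨by simp, Or.inl rfl⟩, hx⟩
      · exact hstep t y ht hB hy hA.1
    · rw [List.length_cons, Nat.even_add_one] at he
      exact absurd hA.2 he
  | bob x h _ hB hx ih =>
    refine ⟨fun ho => ?_, fun _ => Or.inr ⟨x, h, rfl, ih.1 hB.2, hB, hx⟩⟩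
    rw [List.length_cons, Nat.odd_add_one] at ho
    exact absurd hB.2 ho

/-- The slices in `h` are those at the integer positions `u, …, v`. -/
def Occupies {n : ℕ} (h : List (ZMod n)) (u v : ℤ) : Prop :=
  u ≤ v ∧ ∀ a, a ∈ h ↔ ∃ i : ℤ, u ≤ i ∧ i ≤ v ∧ (i : ZMod n) = a

namespace Occupies

variable {n : ℕ} {h : List (ZMod n)} {u v : ℤ}

theorem cons_right (H : Occupies h u v) : Occupies (((v + 1 : ℤ) : ZMod n) :: h) u (v + 1) := by
  refine ⟨by linarith [H.1], fun a => ?_⟩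
  rw [List.mem_cons, H.2]
  constructor
  · rintro (rfl | ⟨i, h1, h2, rfl⟩)
    · exact ⟨v + 1, by linarith [H.1], le_rfl, rfl⟩
    · exact ⟨i, h1, by omega, rfl⟩
  · rintro ⟨i, h1, h2, rfl⟩
    rcases eq_or_lt_of_le h2 with rfl | h3
    · exact Or.inl rfl
    · exact Or.inr ⟨i, h1, by omega, rfl⟩

theorem cons_left (H : Occupies h u v) : Occupies (((u - 1 : ℤ) : ZMod n) :: h) (u - 1) v := by
  refine ⟨by linarith [H.1], fun a => ?_⟩
  rw [List.mem_cons, H.2]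
  constructor
  · rintro (rfl | ⟨i, h1, h2, rfl⟩)
    · exact ⟨u - 1, le_rfl, by linarith [H.1], rfl⟩
    · exact ⟨i, by omega, h2, rfl⟩
  · rintro ⟨i, h1, h2, rfl⟩
    rcases eq_or_lt_of_le h1 with rfl | h3
    · exact Or.inl rfl
    · exact Or.inr ⟨i, by omega, h2, rfl⟩

theorem not_mem (H : Occupies h u v) {x : ℤ} (h1 : v - n < x) (h2 : x < u + n)
    (h3 : x < u ∨ v < x) : (x : ZMod n) ∉ h := by
  rw [H.2]
  rintro ⟨i, hi1, hi2, hi⟩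
  -- The bounds on `x` keep it less than `n` away from every `i` in `u, …, v`, so congruence forces
  -- equality.
  obtain ⟨c, hc⟩ := (ZMod.intCast_eq_intCast_iff_dvd_sub _ _ _).1 hi
  have : c = 0 := by
    rcases lt_trichotomy c 0 with hc0 | hc0 | hc0
    · nlinarith
    · exact hc0
    · nlinarith
  subst this
  omega

theorem legalMove_right (H : Occupies h u v) (hn : v - u + 1 < n) :
    LegalMove h ((v + 1 : ℤ) : ZMod n) :=
  ⟨H.not_mem (by omega) (by omega) (Or.inr (by omega)),
    Or.inr ⟨(v : ZMod n), (H.2 _).2 ⟨v, H.1, le_rfl, rfl⟩, Or.inl (by push_cast; rfl)⟩⟩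

theorem legalMove_left (H : Occupies h u v) (hn : v - u + 1 < n) :
    LegalMove h ((u - 1 : ℤ) : ZMod n) :=
  ⟨H.not_mem (by have := H.1; omega) (by omega) (Or.inl (by omega)),
    Or.inr ⟨(u : ZMod n), (H.2 _).2 ⟨u, le_rfl, H.1, rfl⟩, Or.inr (by push_cast; rfl)⟩⟩

theorem eq_or_eq_of_legalMove (H : Occupies h u v) {y : ZMod n} (hy : LegalMove h y) :
    y = ((v + 1 : ℤ) : ZMod n) ∨ y = ((u - 1 : ℤ) : ZMod n) := by
  obtain ⟨hy1, rfl | ⟨a, ha, hya⟩⟩ := hy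
  · exact absurd ((H.2 (u : ZMod n)).2 ⟨u, le_rfl, H.1, rfl⟩) (by simp)
  rw [H.2] at hy1 ha
  obtain ⟨i, hi1, hi2, rfl⟩ := ha
  rcases hya with rfl | rfl
  · left
    obtain rfl : i = v := by
      by_contra hne
      exact hy1 ⟨i + 1, by omega, by omega, by push_cast; rfl⟩
    push_cast; rfl
  · right
    obtain rfl : i = u := by
      by_contra hne
      exact hy1 ⟨i - 1, by omega, by omega, by push_cast; rfl⟩
    push_cast; rfl

end Occupies

theorem aliceGain_cons_of_odd {n : ℕ} (p : ZMod n → ℝ) (y : ZMod n) {h : List (ZMod n)}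
    (ho : Odd h.length) : aliceGain p (y :: h) = aliceGain p h := by
  simp [aliceGain, Nat.not_even_iff_odd.2 ho]

theorem aliceGain_cons_cons {n : ℕ} (p : ZMod n → ℝ) (x y : ZMod n) {h : List (ZMod n)}
    (ho : Odd h.length) : aliceGain p (x :: y :: h) = aliceGain p h + p x := by
  rw [aliceGain, aliceGain_cons_of_odd p y ho, List.length_cons, if_pos ho.add_one]

theorem aliceJumps_cons_of_odd {n : ℕ} (y : ZMod n) {h : List (ZMod n)} (ho : Odd h.length) :
    aliceJumps (y :: h) = aliceJumps h := by
  cases h with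
  | nil => simp at ho
  | cons z t => rw [aliceJumps, if_neg fun hc => Nat.not_even_iff_odd.2 ho hc.1, add_zero]

theorem aliceJumps_cons_cons_le {n : ℕ} (x y : ZMod n) {h : List (ZMod n)} (ho : Odd h.length) :
    aliceJumps (x :: y :: h) ≤ aliceJumps h + 1 := by
  rw [aliceJumps, aliceJumps_cons_of_odd y ho]
  split_ifs <;> omega

theorem aliceJumps_cons_cons_of_isNeighbor {n : ℕ} {x y : ZMod n} {h : List (ZMod n)}
    (ho : Odd h.length) (hxy : IsNeighbor y x) : aliceJumps (x :: y :: h) = aliceJumps h := by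
  rw [aliceJumps, aliceJumps_cons_of_odd y ho, if_neg fun hc => hc.2 hxy, add_zero]

/-- A winning first turn in the sense of `Win` gives rise to a strategy. -/
theorem exists_strategy_of_win {n m : ℕ} [NeZero n] (hm : n = 2 * m + 1 ∨ n = 2 * m + 2)
    (p : ZMod n → ℝ) (J : ℕ) (G : ℝ) (x : ℤ)
    (hx : Win (fun i => p (i : ZMod n)) m J x x (G - p (x : ZMod n))) :
    ∃ σ : List (ZMod n) → ZMod n, IsAliceStrategy σ ∧ IsJumpStrategy J σ ∧ HasGain p G σ := by
  obtain ⟨σ, hσ, hinv⟩ := exists_strategy_of_invariant (n := n)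
    -- `k` rounds and `j` jumps remain. If `n = 2 * m + 2`, one more slice is left for Bob after the
    -- last round.
    (fun h => ∃ (k j : ℕ) (u v : ℤ), Occupies h u v ∧ (h.length : ℤ) = v - u + 1 ∧
      v - u + 2 * k = 2 * m ∧ aliceJumps h + j ≤ J ∧
      Win (fun i => p (i : ZMod n)) k j u v (G - aliceGain p h))
    ⟨(x : ZMod n), m, J, x, x, ⟨le_rfl, fun a => by
        rw [List.mem_singleton]
        exact ⟨fun h => ⟨x, le_rfl, le_rfl, h.symm⟩, fun ⟨i, h1, h2, h3⟩ => by
          rw [← h3, le_antisymm h2 h1]⟩⟩, by simp, by simp, by simp [aliceJumps],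
        by simpa [aliceGain] using hx⟩
    (by
      rintro h y ⟨k, j, u, v, hocc, hlen, hk, hj, hwin⟩ ⟨-, ho⟩ hy hn
      rw [List.length_cons] at hn
      obtain _ | k := k
      · push_cast at hk; omega
      push_cast at hk
      obtain ⟨hR, hL⟩ := hwin
      rcases hocc.eq_or_eq_of_legalMove hy with rfl | rfl
      · have hocc1 := hocc.cons_right
        rcases hR with hR | ⟨hj0, hR⟩
        · have hocc2 := hocc1.cons_right
          have hleg := hocc1.legalMove_right (by omega)
          rw [show v + 1 + 1 = v + 2 by ring] at hocc2 hleg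
          refine ⟨_, hleg, k, j, u, v + 2, hocc2, ?_, by omega, ?_, ?_⟩
          · simp only [List.length_cons]; push_cast; omega
          · rwa [aliceJumps_cons_cons_of_isNeighbor ho (Or.inl (by push_cast; ring))]
          · rwa [aliceGain_cons_cons p _ _ ho, ← sub_sub]
        · refine ⟨_, hocc1.legalMove_left (by omega), k, j - 1, u - 1, v + 1, hocc1.cons_left, ?_,
            by omega, ?_, ?_⟩
          · simp only [List.length_cons]; push_cast; omega
          · have := aliceJumps_cons_cons_le ((u - 1 : ℤ) : ZMod n) ((v + 1 : ℤ) : ZMod n) ho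
            omega
          · rwa [aliceGain_cons_cons p _ _ ho, ← sub_sub]
      · have hocc1 := hocc.cons_left
        rcases hL with hL | ⟨hj0, hL⟩
        · have hocc2 := hocc1.cons_left
          have hleg := hocc1.legalMove_left (by omega)
          rw [show u - 1 - 1 = u - 2 by ring] at hocc2 hleg
          refine ⟨_, hleg, k, j, u - 2, v, hocc2, ?_, by omega, ?_, ?_⟩
          · simp only [List.length_cons]; push_cast; omega
          · rwa [aliceJumps_cons_cons_of_isNeighbor ho (Or.inr (by push_cast; ring))]
          · rwa [aliceGain_cons_cons p _ _ ho, ← sub_sub]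
        · refine ⟨_, hocc1.legalMove_right (by omega), k, j - 1, u - 1, v + 1, hocc1.cons_right, ?_,
            by omega, ?_, ?_⟩
          · simp only [List.length_cons]; push_cast; omega
          · have := aliceJumps_cons_cons_le ((v + 1 : ℤ) : ZMod n) ((u - 1 : ℤ) : ZMod n) ho
            omega
          · rwa [aliceGain_cons_cons p _ _ ho, ← sub_sub])
  have key : ∀ h, Follows σ h → h.length = n → aliceJumps h ≤ J ∧ G ≤ aliceGain p h := by
    intro h hF hlen
    obtain ⟨hodd, heven⟩ := hinv h hF
    rcases Nat.even_or_odd h.length with he | ho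
    · rcases heven he with rfl | ⟨y, t, rfl, ⟨k, j, u, v, -, hl, hk, hj, hwin⟩, ⟨-, ht⟩, -⟩
      · exact absurd hlen.symm (NeZero.ne n)
      · rw [List.length_cons] at hlen
        rw [aliceJumps_cons_of_odd y ht, aliceGain_cons_of_odd p y ht]
        obtain rfl : k = 0 := by
          obtain ⟨c, hc⟩ := ht
          omega
        exact ⟨by omega, by linarith [show G - aliceGain p t ≤ 0 from hwin]⟩
    · obtain ⟨k, j, u, v, -, hl, hk, hj, hwin⟩ := hodd ho
      obtain rfl : k = 0 := by
        obtain ⟨c, hc⟩ := ho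
        omega
      exact ⟨by omega, by linarith [show G - aliceGain p h ≤ 0 from hwin]⟩
  exact ⟨σ, hσ, fun h hF hl => (key h hF hl).1, fun h hF hl => (key h hF hl).2⟩

end Pizza

theorem theorem1 (n : ℕ) [NeZero n] (p : ZMod n → ℝ) (hp : ∀ i, 0 ≤ p i) :
    ∃ σ : List (ZMod n) → ZMod n,
      Pizza.IsAliceStrategy σ ∧ Pizza.IsJumpStrategy 2 σ ∧
        Pizza.HasGain p (4 * (∑ i, p i) / 9) σ := by
  have hP : 0 ≤ ∑ i, p i := Finset.sum_nonneg fun i _ => hp i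
  have hper : ∀ x : ℤ, p ((x + n : ℤ) : ZMod n) = p (x : ZMod n) := fun x => by simp
  have hsum := Pizza.sum_zmod_eq_sum_range n p
  rcases Nat.even_or_odd' n with ⟨m, hm | hm⟩
  · obtain ⟨m, rfl⟩ : ∃ m', m = m' + 1 :=
      Nat.exists_eq_succ_of_ne_zero (by rintro rfl; exact NeZero.ne n hm)
    have hm' : n = 2 * m + 2 := by omega
    obtain ⟨x, hx⟩ := Pizza.exists_win_of_even (p := fun i => p (i : ZMod n)) (m := m) fun x => by
      have := hper x
      rwa [show (n : ℤ) = 2 * m + 2 by omega] at this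
    rw [← hm', ← hsum] at hx
    obtain ⟨σ, h1, h2, h3⟩ := Pizza.exists_strategy_of_win (Or.inr hm') p 2 _ x hx
    exact ⟨σ, h1, h2, fun h hF hl => le_trans (by linarith) (h3 h hF hl)⟩
  · obtain ⟨S, hS, hSn⟩ := Pizza.exists_prefixSum_of_odd (p := fun i => p (i : ZMod n)) (m := m)
      fun x => by
        have := hper x
        rwa [show (n : ℤ) = 2 * m + 1 by omega] at this
    rw [← hm, ← hsum] at hSn
    obtain ⟨x, hx⟩ := Pizza.exists_win_of_odd hS (fun x => hp x) hSn hP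
    exact Pizza.exists_strategy_of_win (Or.inl hm) p 2 _ x hx
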